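/- Conventions. For an idempotent $e$ of a monoid $M$ (that is, $e^2=e$), the set $eMe=\{eme : m\in M\}$ is a monoid under the product of $M$, with identity element $e$. An element $p$ of a monoid is called irreducible if it is not a unit and, whenever $p=ab$ with $a,b$ in the monoid, $a$ or $b$ is a unit. Two elements $a,b$ of a monoid are called associates if $a=ubv$ for some units $u,v$ of the monoid. An algebra over a field $k$ is said to be of infinite representation type if there are infinitely many isomorphism classes of indecomposable left modules over it that are finite-dimensional over $k$. Corollary. Let $M$ be a finite monoid and let $k$ be a field. If there exists an idempotent $e\in M$ such that the monoid $eMe$ has two irreducible elements that are not associates, then the monoid algebra $kM$ is of infinite representation type. -/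

import Mathlib

universe u v

/-- For an idempotent `e` of a monoid `M`, the monoid `eMe = {e * m * e | m ∈ M}`; its product is
that of `M` and its identity element is `e`. -/
def MonoidCorner {M : Type*} [Monoid M] {e : M} (_he : IsIdempotentElem e) : Type _ :=
  ↥(Subsemigroup.corner e)

instance MonoidCorner.instMonoid {M : Type*} [Monoid M] {e : M} (he : IsIdempotentElem e) :
    Monoid (MonoidCorner he) where
  __ : Semigroup (MonoidCorner he) := inferInstanceAs (Semigroup ↥(Subsemigroup.corner e))
  one := ⟨e, e, by simp only [he.eq]⟩
  one_mul r := Subtype.ext ((Subsemigroup.mem_corner_iff he).mp r.2).1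
  mul_one r := Subtype.ext ((Subsemigroup.mem_corner_iff he).mp r.2).2

/-- Two-sided associates in a (not necessarily commutative) monoid: `a = u * b * v` for some units
`u` and `v`. (Mathlib's `Associated` allows a unit on the right only.) -/
def AreAssociates {M : Type*} [Monoid M] (a b : M) : Prop :=
  ∃ u v : Mˣ, a = ↑u * b * ↑v

open CategoryTheory in
open scoped ModuleCat in
/-- The set of isomorphism classes of those left `A`-modules that are finite-dimensional over `k`
and indecomposable, for an algebra `A` over a field `k`. Every module that is finite-dimensional
over `k` has a copy in the universe of `k`, so it is enough to consider modules there. -/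
def indecomposableIsoClasses (k : Type u) [Field k] (A : Type v) [Ring A] [Algebra k A] :
    Set (Quotient (isIsomorphicSetoid (ModuleCat.{u} A))) :=
  {c | ∃ V : ModuleCat.{u} A, Module.Finite k V ∧ Indecomposable V ∧ Quotient.mk _ V = c}

/-- A `k`-algebra has infinite representation type if it has infinitely many isomorphism classes of
finite-dimensional indecomposable left modules. -/
def HasInfiniteRepresentationType (k : Type u) [Field k] (A : Type v) [Ring A] [Algebra k A] :
    Prop :=
  (indecomposableIsoClasses k A).Infinite

/-! Put N = eMe. As N is finite, a product of two nonunits of N is a nonunit, and irreducibility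
keeps it from being an associate of p or q. So N acts on L × L, with L = k[X]/(X^(n+1)), by letting
p and q act as the two Kronecker maps (a, b) ↦ (0, a) and (a, b) ↦ (0, Xa), whose products all
vanish (`irreduciblePairHom`). Since L has only trivial idempotents, so does the endomorphism ring
of this module (`eq_zero_or_one_of_commute_shiftMul`). Coinduction from N to M preserves this
property and does not lower the dimension, so kM has indecomposables of unbounded finite dimension.
-/

/-- A representation has only trivial idempotent endomorphisms, that is, it is zero or
indecomposable. -/
def Representation.HasTrivialIdempotents {k M V : Type*} [CommSemiring k] [Monoid M]
    [AddCommGroup V] [Module k V] (ρ : Representation k M V) : Prop :=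
  ∀ T : Module.End k V, (∀ m, T * ρ m = ρ m * T) → T * T = T → T = 0 ∨ T = 1

/-! ### Indecomposability from idempotent endomorphisms -/

section Indecomposable

open CategoryTheory CategoryTheory.Limits

theorem CategoryTheory.indecomposable_of_idempotents {C : Type*} [Category* C] [Preadditive C]
    [HasBinaryBiproducts C] {X : C} (hX : ¬ IsZero X)
    (h : ∀ f : X ⟶ X, f ≫ f = f → f = 0 ∨ f = 𝟙 X) : Indecomposable X := by
  refine ⟨hX, fun Y Z i => ?_⟩
  have hf : (i.hom ≫ biprod.fst ≫ biprod.inl ≫ i.inv) ≫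
      (i.hom ≫ biprod.fst ≫ biprod.inl ≫ i.inv) = i.hom ≫ biprod.fst ≫ biprod.inl ≫ i.inv := by
    simp
  rcases h _ hf with h0 | h1
  · left
    have := (biprod.inl ≫ i.inv) ≫= h0 =≫ (i.hom ≫ biprod.fst)
    rw [IsZero.iff_id_eq_zero]
    simpa using this
  · right
    have := (biprod.inr ≫ i.inv) ≫= h1 =≫ (i.hom ≫ biprod.snd)
    rw [IsZero.iff_id_eq_zero]
    simpa using this.symm

theorem Representation.HasTrivialIdempotents.indecomposable {k M : Type*} [Field k] [Monoid M]
    {V : Type*} [AddCommGroup V] [Module k V] [Nontrivial V] {ρ : Representation k M V}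
    (h : ρ.HasTrivialIdempotents) :
    Indecomposable (ModuleCat.of (MonoidAlgebra k M) ρ.asModule) := by
  refine CategoryTheory.indecomposable_of_idempotents ?_ fun f hf => ?_
  · rw [ModuleCat.isZero_iff_subsingleton]
    exact not_subsingleton_iff_nontrivial.mpr ‹Nontrivial V›
  · let T : Module.End k V :=
      ρ.asModuleEquiv.toLinearMap ∘ₗ (f.hom.restrictScalars k) ∘ₗ ρ.asModuleEquiv.symm.toLinearMap
    have hT (v : V) : T v = f.hom (ρ.asModuleEquiv.symm v) := rfl
    have hc (m : M) : T * ρ m = ρ m * T := by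
      ext v
      have hmap := f.hom.map_smul (MonoidAlgebra.of k M m) (ρ.asModuleEquiv.symm v)
      refine Eq.trans ?_ (asModuleEquiv_symm_map_rho ρ m (T v)).symm
      refine Eq.trans ?_ hmap
      exact congrArg f.hom (asModuleEquiv_symm_map_rho ρ m v)
    have hi : T * T = T := by
      ext v
      exact congr($(hf).hom v)
    rcases h T hc hi with h0 | h1
    · left
      ext v
      exact congr($h0 v)
    · right
      ext v
      exact congr($h1 v)

end Indecomposable

/-- Transport of a representation along a linear equivalence. -/
def Representation.transport {k M V W : Type*} [CommSemiring k] [Monoid M]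
    [AddCommGroup V] [Module k V] [AddCommGroup W] [Module k W] (ρ : Representation k M V)
    (i : V ≃ₗ[k] W) : Representation k M W :=
  (i.conjRingEquiv : Module.End k V →* Module.End k W).comp ρ

theorem Representation.HasTrivialIdempotents.transport {k M V W : Type*} [CommSemiring k]
    [Monoid M] [AddCommGroup V] [Module k V] [AddCommGroup W] [Module k W]
    {ρ : Representation k M V} (h : ρ.HasTrivialIdempotents) (i : V ≃ₗ[k] W) :
    (ρ.transport i).HasTrivialIdempotents := by
  intro T hc hi
  have hc' (m : M) : i.conjRingEquiv.symm T * ρ m = ρ m * i.conjRingEquiv.symm T := by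
    apply i.conjRingEquiv.injective
    simpa using! hc m
  have := h (i.conjRingEquiv.symm T) hc' (by rw [← map_mul, hi])
  simpa using this

open scoped ModuleCat in
theorem ModuleCat.nonempty_linearEquiv_of_addEquiv {k A V : Type*} [Field k] [Ring A] [Algebra k A]
    [AddCommGroup V] [Module k V] {X : ModuleCat A} (g : X ≃+ V)
    (hg : ∀ (c : k) (x : X), g (algebraMap k A c • x) = c • g x) : Nonempty (X ≃ₗ[k] V) :=
  ⟨g.toLinearEquiv hg⟩

open CategoryTheory in
open scoped ModuleCat in
theorem hasInfiniteRepresentationType_of_unbounded {k : Type u} [Field k] {M : Type v} [Monoid M]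
    (h : ∀ n : ℕ, ∃ (V : Type (max u v)) (_ : AddCommGroup V) (_ : Module k V)
      (_ : Module.Finite k V) (ρ : Representation k M V),
      n < Module.finrank k V ∧ ρ.HasTrivialIdempotents) :
    HasInfiniteRepresentationType k (MonoidAlgebra k M) := by
  let d : Quotient (isIsomorphicSetoid (ModuleCat.{u} (MonoidAlgebra k M))) → ℕ :=
    Quotient.lift (fun V => Module.finrank k V) fun V W ⟨i⟩ =>
      (i.toLinearEquiv.restrictScalars k).finrank_eq
  refine Set.Infinite.of_image d (Set.infinite_of_not_bddAbove ?_)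
  rintro ⟨n, hn⟩
  obtain ⟨V, _, _, _, ρ, hV, hρ⟩ := h n
  have : Nontrivial (Fin (Module.finrank k V) → k) :=
    have : Nonempty (Fin (Module.finrank k V)) := ⟨⟨0, by omega⟩⟩
    inferInstance
  -- Coordinates move the module into the universe of `k`.
  let σ := ρ.transport (Module.finBasis k V).equivFun
  have hσ : Indecomposable (ModuleCat.of (MonoidAlgebra k M) σ.asModule) :=
    (hρ.transport _).indecomposable
  obtain ⟨X, hX, ⟨j⟩⟩ : ∃ X : ModuleCat.{u} (MonoidAlgebra k M), Indecomposable X ∧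
      Nonempty (X ≃ₗ[k] (Fin (Module.finrank k V) → k)) :=
    ⟨_, hσ, ModuleCat.nonempty_linearEquiv_of_addEquiv σ.asModuleEquiv.toAddEquiv fun c x =>
      algebraMap_smul (M := σ.asModule) (MonoidAlgebra k M) c x⟩
  have hd : Module.finrank k V ∈ d '' indecomposableIsoClasses k (MonoidAlgebra k M) :=
    ⟨_, ⟨X, Module.Finite.equiv j.symm, hX, rfl⟩, j.finrank_eq.trans (by simp)⟩
  exact absurd (hn hd) (by omega)

/-! ### Coinduction from eMe to M -/

section Coinduction

variable {k M W : Type*} [Field k] [Monoid M] {e : M} {he : IsIdempotentElem e}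
  [AddCommGroup W] [Module k W]

/-- The underlying space of the coinduction to `M` of a representation of `eMe`. -/
def coinducedSpace (ρ : Representation k (MonoidCorner he) W) : Submodule k (M → W) where
  carrier := {f | ∀ (n : MonoidCorner he) (x : M), f (n.1 * x) = ρ n (f x)}
  add_mem' hf hg n x := by simp [hf n x, hg n x]
  zero_mem' n x := by simp
  smul_mem' c f hf n x := by simp [hf n x]

/-- The coinduction to `M` of a representation of `eMe`. -/
def coinducedRepresentation (ρ : Representation k (MonoidCorner he) W) :
    Representation k M (coinducedSpace ρ) where
  toFun m := ((LinearMap.funLeft k W (· * m)).restrict fun f hf n x => by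
    simpa [LinearMap.funLeft_apply, mul_assoc] using hf n (x * m))
  map_one' := by ext; simp [LinearMap.funLeft_apply]
  map_mul' a b := by
    ext f x
    exact congrArg f.1 (mul_assoc x a b).symm

@[simp]
theorem coinducedRepresentation_apply (ρ : Representation k (MonoidCorner he) W) (m : M)
    (f : coinducedSpace ρ) (x : M) : (coinducedRepresentation ρ m f).1 x = f.1 (x * m) := rfl

namespace MonoidCorner

/-- The element `e * x * e` of `eMe`. -/
def mk (he : IsIdempotentElem e) (x : M) : MonoidCorner he := ⟨e * x * e, x, rfl⟩

theorem left_mul (n : MonoidCorner he) : e * n.1 = n.1 :=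
  ((Subsemigroup.mem_corner_iff he).mp n.2).1

theorem mul_right (n : MonoidCorner he) : n.1 * e = n.1 :=
  ((Subsemigroup.mem_corner_iff he).mp n.2).2

theorem coe_mul (a b : MonoidCorner he) : (a * b).1 = a.1 * b.1 := rfl

theorem coe_one : (1 : MonoidCorner he).1 = e := rfl

theorem mk_coe_mul (n : MonoidCorner he) (x : M) : mk he (n.1 * x) = n * mk he x := by
  apply Subtype.ext
  rw [coe_mul]
  simp only [mk, ← mul_assoc, left_mul, mul_right]

theorem mk_mul_coe (x : M) (n : MonoidCorner he) : mk he (x * n.1) = mk he x * n := by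
  apply Subtype.ext
  rw [coe_mul]
  simp only [mk, mul_assoc, left_mul, mul_right]

theorem mk_one : mk he 1 = 1 := Subtype.ext (by simp [mk, coe_one, he.eq])

end MonoidCorner

open MonoidCorner

theorem coinducedSpace_apply_left_mul {ρ : Representation k (MonoidCorner he) W}
    (f : coinducedSpace ρ) (x : M) : f.1 (e * x) = f.1 x := by
  simpa [coe_one] using f.2 1 x

/-- The embedding of a representation of `eMe` into its coinduction to `M`. -/
def toCoinduced (ρ : Representation k (MonoidCorner he) W) : W →ₗ[k] coinducedSpace ρ where
  toFun w := ⟨fun x => ρ (mk he x) w, fun n x => by simp [mk_coe_mul]⟩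
  map_add' _ _ := by ext; simp
  map_smul' _ _ := by ext; simp

@[simp]
theorem toCoinduced_apply (ρ : Representation k (MonoidCorner he) W) (w : W) (x : M) :
    (toCoinduced ρ w).1 x = ρ (mk he x) w := rfl

theorem toCoinduced_injective (ρ : Representation k (MonoidCorner he) W) :
    Function.Injective (toCoinduced ρ) := fun v w h => by
  simpa [mk_one] using congr(($h).1 1)

/-- By equivariance f(xe) = f(exe) = ρ(exe) f(1), so `e` projects onto the copy of `W`. -/
theorem coinducedRepresentation_idempotent (ρ : Representation k (MonoidCorner he) W)
    (f : coinducedSpace ρ) : coinducedRepresentation ρ e f = toCoinduced ρ (f.1 1) := by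
  ext x
  have := f.2 (mk he x) 1
  simp only [mk, mul_one, mul_assoc, coinducedSpace_apply_left_mul] at this
  simpa [mk, mul_assoc] using this

theorem coinducedRepresentation_toCoinduced (ρ : Representation k (MonoidCorner he) W)
    (n : MonoidCorner he) (w : W) :
    coinducedRepresentation ρ n.1 (toCoinduced ρ w) = toCoinduced ρ (ρ n w) := by
  ext x
  simp [mk_mul_coe]

/-- An endomorphism `T` acts pointwise through its restriction `S` to the copy of `W`: f(x) is the
value at 1 of x · f, and values at 1 are read off after applying `e`. -/
theorem Representation.HasTrivialIdempotents.coinduced {ρ : Representation k (MonoidCorner he) W}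
    (h : ρ.HasTrivialIdempotents) : (coinducedRepresentation ρ).HasTrivialIdempotents := by
  intro T hc hi
  have hc' (m : M) (f) : T (coinducedRepresentation ρ m f) = coinducedRepresentation ρ m (T f) :=
    congr($(hc m) f)
  have hi' (f) : T (T f) = T f := congr($hi f)
  let S : Module.End k W :=
    LinearMap.proj (1 : M) ∘ₗ (coinducedSpace ρ).subtype ∘ₗ T ∘ₗ toCoinduced ρ
  have hS (w : W) : S w = (T (toCoinduced ρ w)).1 1 := rfl
  have hT (f : coinducedSpace ρ) (x : M) : (T f).1 x = S (f.1 x) := by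
    have h1 := hc' e (coinducedRepresentation ρ x f)
    rw [coinducedRepresentation_idempotent, hc', coinducedRepresentation_apply, one_mul] at h1
    rw [hS, h1]
    simp [coinducedSpace_apply_left_mul]
  have hSc (n) : S * ρ n = ρ n * S := by
    ext w
    simp only [Module.End.mul_apply]
    rw [hS, ← coinducedRepresentation_toCoinduced, hc', coinducedRepresentation_apply, one_mul, hS]
    simpa using (T (toCoinduced ρ w)).2 n 1
  have hSi : S * S = S := by
    ext w
    simp only [Module.End.mul_apply]
    rw [hS w, ← hT, hi']
  rcases h S hSc hSi with h0 | h1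
  · left
    ext f x
    simp [hT, h0]
  · right
    ext f x
    simp [hT, h1]

end Coinduction

/-! ### Associates and irreducible elements -/

section Irreducible

variable {N : Type*} [Monoid N]

theorem AreAssociates.refl (a : N) : AreAssociates a a := ⟨1, 1, by simp⟩

theorem AreAssociates.symm {a b : N} (h : AreAssociates a b) : AreAssociates b a := by
  obtain ⟨u, v, rfl⟩ := h
  exact ⟨u⁻¹, v⁻¹, by simp [mul_assoc]⟩

theorem AreAssociates.trans {a b c : N} (h : AreAssociates a b) (h' : AreAssociates b c) :
    AreAssociates a c := by
  obtain ⟨u, v, rfl⟩ := h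
  obtain ⟨u', v', rfl⟩ := h'
  exact ⟨u * u', v' * v, by simp [mul_assoc]⟩

theorem IsUnit.areAssociates_mul_left {u : N} (hu : IsUnit u) (a : N) :
    AreAssociates (u * a) a := by
  obtain ⟨u, rfl⟩ := hu
  exact ⟨u, 1, by simp⟩

theorem IsUnit.areAssociates_mul_right {u : N} (hu : IsUnit u) (a : N) :
    AreAssociates (a * u) a := by
  obtain ⟨u, rfl⟩ := hu
  exact ⟨1, u, by simp⟩

theorem AreAssociates.isUnit_iff {a b : N} (h : AreAssociates a b) : IsUnit a ↔ IsUnit b := by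
  obtain ⟨u, v, rfl⟩ := h
  simp

theorem AreAssociates.congr_left {a b : N} (h : AreAssociates a b) (c : N) :
    AreAssociates a c ↔ AreAssociates b c := ⟨h.symm.trans, h.trans⟩

theorem Irreducible.not_areAssociates_mul {p a b : N} (hp : Irreducible p) (ha : ¬ IsUnit a)
    (hb : ¬ IsUnit b) : ¬ AreAssociates (a * b) p := by
  intro h
  obtain ⟨u, v, huv⟩ := h.symm
  rcases hp.isUnit_or_isUnit (a := ↑u * a) (b := b * ↑v) (by simp [huv, mul_assoc]) with h | h
  · exact ha (by simpa using h)
  · exact hb (by simpa using h)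

open Classical in
/-- The homomorphism that sends units to `1`, associates of `p` to `x`, associates of `q` to `y`,
and all other elements to `0`, where all products of `x` and `y` vanish. -/
noncomputable def irreduciblePairHom [IsDedekindFiniteMonoid N] {R : Type*} [MonoidWithZero R]
    {p q : N} (hp : Irreducible p) (hq : Irreducible q)
    {x y : R} (hxx : x * x = 0) (hxy : x * y = 0) (hyx : y * x = 0) (hyy : y * y = 0) :
    N →* R where
  toFun n := if IsUnit n then 1 else if AreAssociates n p then x else
    if AreAssociates n q then y else 0
  map_one' := by simp
  map_mul' a b := by
    by_cases ha : IsUnit a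
    · have h := ha.areAssociates_mul_left b
      simp only [h.isUnit_iff, h.congr_left, ha, if_true, one_mul]
    by_cases hb : IsUnit b
    · have h := hb.areAssociates_mul_right a
      simp only [h.isUnit_iff, h.congr_left, hb, if_true, mul_one]
    -- Dedekind finiteness is needed here: a factor of a unit is a unit.
    have hab : ¬ IsUnit (a * b) := fun h => ha (isUnit_of_mul_isUnit_left h)
    simp only [ha, hb, hab, hp.not_areAssociates_mul ha hb, hq.not_areAssociates_mul ha hb, if_false]
    split_ifs <;> simp [*]

end Irreducible

/-! ### Kronecker modules -/

section Kronecker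

variable {k L : Type*} [Field k] [CommRing L] [Algebra k L]

/-- The endomorphism `(a, b) ↦ (0, t * a)` of `L × L`. -/
def shiftMul (k : Type*) {L : Type*} [Field k] [CommRing L] [Algebra k L] (t : L) :
    Module.End k (L × L) :=
  LinearMap.inr k L L ∘ₗ LinearMap.mulLeft k t ∘ₗ LinearMap.fst k L L

@[simp]
theorem shiftMul_apply (t : L) (v : L × L) : shiftMul k t v = (0, t * v.1) := rfl

theorem shiftMul_mul_shiftMul (s t : L) : shiftMul k s * shiftMul k t = 0 := by
  ext <;> simp

theorem eq_zero_or_one_of_commute_shiftMul {t : L} (ht : Algebra.adjoin k {t} = ⊤)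
    (hL : ∀ a : L, a * a = a → a = 0 ∨ a = 1) {T : Module.End k (L × L)}
    (h1 : T * shiftMul k 1 = shiftMul k 1 * T) (h2 : T * shiftMul k t = shiftMul k t * T)
    (hT : T * T = T) : T = 0 ∨ T = 1 := by
  have h1' (v) : T (0, v.1) = (0, (T v).1) := by simpa using congr($h1 v)
  have h2' (v) : T (0, t * v.1) = (0, t * (T v).1) := by simpa using congr($h2 v)
  have hT' (v) : T (T v) = T v := congr($hT v)
  -- The scalars `s` that commute with the upper diagonal block of `T` form a subalgebra; it
  -- contains `t` because the lower block equals the upper one.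
  have hmul (s a : L) : (T (s * a, 0)).1 = s * (T (a, 0)).1 := by
    have hs : s ∈ Algebra.adjoin k {t} := ht ▸ Algebra.mem_top
    induction hs using Algebra.adjoin_induction generalizing a with
    | mem s hs =>
      obtain rfl := hs
      have := (h1' (s * a, 0)).symm.trans (h2' (a, 0))
      simpa using this
    | algebraMap c =>
      have := congr(($(T.map_smul c (a, 0))).1)
      simpa [Algebra.smul_def] using this
    | add x y _ _ hx hy =>
      have := congr(($(T.map_add (x * a, 0) (y * a, 0))).1)
      simp only [Prod.mk_add_mk, add_zero, Prod.fst_add, hx, hy] at this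
      rw [add_mul, this, add_mul]
    | mul x y _ _ hx hy => rw [mul_assoc, hx, hy, mul_assoc]
  set c := (T (1, 0)).1 with hc
  have hfst (a : L) : (T (a, 0)).1 = c * a := by simpa [mul_comm] using hmul a 1
  have hsnd (b : L) : T (0, b) = (0, c * b) := by simpa [hfst] using h1' (b, 0)
  let D : L → L := fun a => (T (a, 0)).2
  have hform (a b : L) : T (a, b) = (c * a, D a + c * b) := by
    have : ((a, b) : L × L) = (a, 0) + (0, b) := by simp
    rw [this, map_add, hsnd]
    ext <;> simp [hfst, D]
  -- Idempotency gives c² = c and D(ca) + cD(a) = D(a), which forces D = 0 both for c = 0 and for c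
  -- = 1.
  have hTT (a : L) := hT' (a, 0)
  simp only [hform, mul_zero, add_zero, Prod.mk.injEq] at hTT
  have hcc : c * c = c := by simpa using (hTT 1).1
  rcases hL c hcc with h0 | h0
  · left
    have hD (a : L) : D a = 0 := by
      have h00 : D 0 = 0 := by simp [D, Prod.mk_zero_zero]
      simpa [h0, h00] using (hTT a).2.symm
    refine LinearMap.ext fun ⟨a, b⟩ => ?_
    simp [hform, h0, hD]
  · right
    have hD (a : L) : D a = 0 := by simpa [h0] using (hTT a).2
    refine LinearMap.ext fun ⟨a, b⟩ => ?_
    simp [hform, h0, hD]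

end Kronecker

-- The prime X divides at most one of f and f - 1, so X^n divides the other.
open Polynomial in
theorem AdjoinRoot.eq_zero_or_one_of_mul_self_X_pow {k : Type*} [Field k] (n : ℕ)
    (a : AdjoinRoot (X ^ n : k[X])) (ha : a * a = a) : a = 0 ∨ a = 1 := by
  obtain ⟨f, rfl⟩ := AdjoinRoot.mk_surjective a
  have hdvd : (X ^ n : k[X]) ∣ f * (f - 1) := by
    rw [← AdjoinRoot.mk_eq_zero]
    simp [mul_sub, ha]
  by_cases hf : X ∣ f
  · left
    rw [AdjoinRoot.mk_eq_zero]
    refine prime_X.pow_dvd_of_dvd_mul_right n (fun h => ?_) hdvd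
    exact prime_X.not_isUnit (isUnit_of_dvd_one (by simpa using dvd_sub hf h))
  · right
    rw [← sub_eq_zero, ← map_one (AdjoinRoot.mk _), ← map_sub, AdjoinRoot.mk_eq_zero]
    exact prime_X.pow_dvd_of_dvd_mul_left n hf hdvd

open Polynomial in
theorem Irreducible.exists_representation_hasTrivialIdempotents {N : Type*} [Monoid N]
    [IsDedekindFiniteMonoid N] {p q : N} (hp : Irreducible p) (hq : Irreducible q)
    (hpq : ¬ AreAssociates p q) (k : Type u) [Field k] (n : ℕ) :
    ∃ (V : Type u) (_ : AddCommGroup V) (_ : Module k V)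
      (_ : Module.Finite k V) (ρ : Representation k N V),
      n < Module.finrank k V ∧ ρ.HasTrivialIdempotents := by
  have hmonic : (X ^ (n + 1) : k[X]).Monic := monic_X_pow _
  have hfin := hmonic.finite_adjoinRoot
  have hfree := hmonic.free_adjoinRoot
  let t := AdjoinRoot.root (X ^ (n + 1) : k[X])
  let ρ : Representation k N (AdjoinRoot (X ^ (n + 1) : k[X]) × AdjoinRoot (X ^ (n + 1) : k[X])) :=
    irreduciblePairHom hp hq (shiftMul_mul_shiftMul 1 1) (shiftMul_mul_shiftMul 1 t)
      (shiftMul_mul_shiftMul t 1) (shiftMul_mul_shiftMul t t)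
  refine ⟨_, _, _, inferInstance, ρ, ?_, fun T hc hi => ?_⟩
  · have := (AdjoinRoot.powerBasis' hmonic).finrank
    rw [AdjoinRoot.powerBasis'_dim, natDegree_X_pow] at this
    rw [Module.finrank_prod, this]
    omega
  · have h1 : ρ p = shiftMul k 1 := by
      simp [ρ, irreduciblePairHom, hp.not_isUnit, AreAssociates.refl]
    have h2 : ρ q = shiftMul k t := by
      have : ¬ AreAssociates q p := fun h => hpq h.symm
      simp [ρ, irreduciblePairHom, hq.not_isUnit, AreAssociates.refl, this]
    exact eq_zero_or_one_of_commute_shiftMul AdjoinRoot.adjoinRoot_eq_top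
      (AdjoinRoot.eq_zero_or_one_of_mul_self_X_pow _) (h1 ▸ hc p) (h2 ▸ hc q) hi

theorem mainTheorem4 {M : Type*} [Monoid M] [Finite M] {k : Type*} [Field k]
    (h : ∃ (e : M) (he : IsIdempotentElem e) (p q : MonoidCorner he),
      Irreducible p ∧ Irreducible q ∧ ¬ AreAssociates p q) :
    HasInfiniteRepresentationType k (MonoidAlgebra k M) := by
  obtain ⟨e, he, p, q, hp, hq, hpq⟩ := h
  have : Finite (MonoidCorner he) := inferInstanceAs (Finite ↥(Subsemigroup.corner e))
  refine hasInfiniteRepresentationType_of_unbounded fun n => ?_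
  obtain ⟨W, _, _, _, ρ, hn, hρ⟩ :=
    hp.exists_representation_hasTrivialIdempotents hq hpq k n
  exact ⟨_, _, _, inferInstance, coinducedRepresentation ρ,
    hn.trans_le (LinearMap.finrank_le_finrank_of_injective (toCoinduced_injective ρ)),
    hρ.coinduced⟩
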